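/- Let $\mathcal H$ be a complex Hilbert space and let $T$ be a maximal dissipative operator in $\mathcal H$, i.e. a densely defined linear operator with $\operatorname{Im}(Tf,f)\ge 0$ for all $f\in\operatorname{dom}T$ that has no proper extension in $\mathcal H$ with this property. Put $\gamma_T[f]=\operatorname{Im}(Tf,f)$, $f\in\operatorname{dom}T$, and write $T\in\mathbf D_{\rm sing}$ if $\gamma_T$ is singular: for every $\varphi\in\operatorname{dom}T$ there is a sequence $\varphi_n\in\operatorname{dom}T$ with $\varphi_n\to0$ in $\mathcal H$ and $\gamma_T[\varphi-\varphi_n]\to0$. Let $\mathfrak S_T=\{f\in\operatorname{dom}T:\operatorname{Im}(Tf,f)=0\}$ (a linear manifold), let $\mathfrak L=\mathfrak S_T^{\perp}$, let $S=T{\upharpoonright}\mathfrak S_T$ be the Hermitian part of $T$, and for $\operatorname{Im}\mu\neq0$ let $\mathfrak N_\mu=\big((T-\bar\mu I)\mathfrak S_T\big)^\perp$ be its deficiency subspaces. For $\operatorname{Im}\lambda>0$ let $Y_\lambda=(T-\lambda I)(T-\bar\lambda I)^{-1}$ be the Cayley transform of $T$ (an everywhere defined contraction) and $M_\lambda=Y_\lambda{\upharpoonright}\mathfrak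 N_\lambda:\mathfrak N_\lambda\to\mathfrak N_{\bar\lambda}$. For a contraction $Z$ put $D_Z=(I-Z^*Z)^{1/2}$, and let $P_{\mathfrak N}$ denote the orthogonal projection onto $\mathfrak N$. (1) Suppose $\mathfrak S_T\ne\{0\}$. Then for every $\lambda$ with $\operatorname{Im}\lambda>0$ the following are equivalent: (i) $T\in\mathbf D_{\rm sing}$; (ii) $\operatorname{ran}D_{M_\lambda^*}\cap(P_{\mathfrak N_{\bar\lambda}}-M_\lambda P_{\mathfrak N_\lambda})\mathfrak L=\{0\}$; (iii) $\operatorname{ran}D_{M_\lambda}\cap(P_{\mathfrak N_{\lambda}}-M_\lambda^* P_{\mathfrak N_{\bar\lambda}})\mathfrak L=\{0\}$. In particular: (a) if $\mathfrak S_T$ is dense in $\mathcal H$, then $T\in\mathbf D_{\rm sing}$; (b) if $\mathfrak S_T\neq\{0\}$, $\mathfrak S_T$ is not dense in $\mathcal H$, and $\|M_\lambda\|<1$ for some $\lambda$ with $\operatorname{Im}\lambda>0$, then $T\notin\mathbf D_{\rm sing}$. The inequality $\|M_\lambda\|<1$ holds whenever $\dim\mathfrak N_\lambda<\infty$. (2)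 If $T\in\mathbf D_{\rm sing}$, then $\mathfrak S_T=\operatorname{dom}T\cap\operatorname{dom}T^*$. Corollary. If $T\in\mathbf D_{\rm sing}$ and $\mathfrak S_T$ is nontrivial and not dense in $\mathcal H$, then both deficiency indices of the Hermitian part $S$ are infinite, i.e. $\dim\mathfrak N_\mu=\infty$ for all $\mu$ with $\operatorname{Im}\mu\ne0$. -/

import Mathlib

open scoped ComplexConjugate

noncomputable section

namespace DissipativeOp

variable {H : Type*} [NormedAddCommGroup H] [InnerProductSpace ℂ H]

/-- A (not necessarily densely defined, not necessarily bounded) operator `T` is dissipative if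
`Im (T f, f) ≥ 0` for all `f ∈ dom T`.  With the inner product `(·, ·)` linear in the
first argument, `(T f, f)` is Mathlib's `inner ℂ f (T f)`. -/
def IsDissipative (T : H →ₗ.[ℂ] H) : Prop :=
  ∀ f : T.domain, 0 ≤ (inner ℂ (f : H) (T f)).im

/-- A densely defined dissipative operator without proper dissipative extensions in `H`. -/
structure IsMaximalDissipative (T : H →ₗ.[ℂ] H) : Prop where
  dense_domain : Dense (T.domain : Set H)
  dissipative : IsDissipative T
  maximal : ∀ T' : H →ₗ.[ℂ] H, IsDissipative T' → T ≤ T' → T' = T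

/-- The quadratic form `γ_T[f] = Im (T f, f)`, `dom γ_T = dom T`. -/
def gammaForm (T : H →ₗ.[ℂ] H) (f : T.domain) : ℝ := (inner ℂ (f : H) (T f)).im

/-- Singularity of a nonnegative quadratic form `a` with domain `D ⊆ H`: each `φ ∈ D` can be
approximated in the form by a sequence in `D` which tends to zero in `H`. -/
def IsSingularForm {D : Submodule ℂ H} (a : D → ℝ) : Prop :=
  ∀ φ : D, ∃ u : ℕ → D,
    Filter.Tendsto (fun n => (u n : H)) Filter.atTop (nhds 0) ∧
    Filter.Tendsto (fun n => a (φ - u n)) Filter.atTop (nhds 0)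

/-- The class `D_sing` of maximal dissipative operators whose form `γ_T` is singular. -/
def DSing (T : H →ₗ.[ℂ] H) : Prop :=
  IsMaximalDissipative T ∧ IsSingularForm (gammaForm T)

/-- The operator `T - z I : dom T → H`. -/
def shift (T : H →ₗ.[ℂ] H) (z : ℂ) : T.domain →ₗ[ℂ] H :=
  T.toFun - z • T.domain.subtype

theorem shift_apply (T : H →ₗ.[ℂ] H) (z : ℂ) (f : T.domain) :
    shift T z f = T f - z • (f : H) := rfl

/-- `‖(T - z̄) f‖² - ‖(T - z) f‖² = 4 Im z Im (T f, f)`. -/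
theorem norm_shift_sq (T : H →ₗ.[ℂ] H) (z : ℂ) (f : T.domain) :
    ‖shift T (conj z) f‖ ^ 2 - ‖shift T z f‖ ^ 2 = 4 * z.im * (inner ℂ (f : H) (T f)).im := by
  rw [shift_apply, shift_apply, @norm_sub_sq ℂ, @norm_sub_sq ℂ, norm_smul, norm_smul,
    inner_smul_right, inner_smul_right, ← inner_conj_symm (T f) (f : H)]
  simp only [RCLike.mul_re, RCLike.conj_re, RCLike.conj_im, RCLike.re_to_complex,
    RCLike.im_to_complex, RCLike.norm_conj]
  ring

theorem norm_shift_le {T : H →ₗ.[ℂ] H} (hT : IsDissipative T) {z : ℂ} (hz : 0 < z.im)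
    (f : T.domain) : ‖shift T z f‖ ≤ 1 * ‖shift T (conj z) f‖ := by
  rw [one_mul]
  have h := norm_shift_sq T z f
  have h2 : 0 ≤ 4 * z.im * (inner ℂ (f : H) (T f)).im := by
    have := hT f
    positivity
  exact abs_le_of_sq_le_sq' (by linarith) (norm_nonneg _) |>.2

theorem shift_conj_sub (T : H →ₗ.[ℂ] H) (z : ℂ) (f : T.domain) :
    shift T (conj z) f - shift T z f = (z - conj z) • (f : H) := by
  rw [shift_apply, shift_apply, sub_smul]
  abel

theorem sub_conj_ne_zero {z : ℂ} (hz : 0 < z.im) : z - conj z ≠ 0 := by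
  intro h
  have := congrArg Complex.im h
  simp at this
  linarith

theorem shift_injective {T : H →ₗ.[ℂ] H} (hT : IsDissipative T) {z : ℂ} (hz : 0 < z.im) :
    Function.Injective (shift T (conj z)) := by
  rw [injective_iff_map_eq_zero]
  intro f hf
  have h1 := norm_shift_le hT hz f
  rw [hf, norm_zero, mul_zero, norm_le_zero_iff] at h1
  have h2 := shift_conj_sub T z f
  rw [hf, h1, sub_zero] at h2
  exact Subtype.ext ((smul_eq_zero.1 h2.symm).resolve_left (sub_conj_ne_zero hz))

section Complete

variable [CompleteSpace H]

/-- If a contraction attains its norm at `ψ` then `Y* Y ψ = ψ`. -/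
theorem adjoint_apply_of_norm_eq {Y : H →L[ℂ] H} (hY : ∀ x, ‖Y x‖ ≤ ‖x‖) {ψ : H}
    (hψ : ‖Y ψ‖ = ‖ψ‖) : (ContinuousLinearMap.adjoint Y) (Y ψ) = ψ := by
  have hA : ‖ContinuousLinearMap.adjoint Y‖ ≤ 1 := by
    rw [LinearIsometryEquiv.norm_map]
    exact Y.opNorm_le_bound zero_le_one (by simpa using hY)
  have h1 : ‖(ContinuousLinearMap.adjoint Y) (Y ψ)‖ ≤ ‖ψ‖ := by
    have := (ContinuousLinearMap.adjoint Y).le_of_opNorm_le hA (Y ψ)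
    rwa [one_mul, hψ] at this
  have h2 : ‖(ContinuousLinearMap.adjoint Y) (Y ψ) - ψ‖ ^ 2 ≤ 0 := by
    rw [@norm_sub_sq ℂ, ContinuousLinearMap.adjoint_inner_left, inner_self_eq_norm_sq, hψ]
    nlinarith [norm_nonneg ((ContinuousLinearMap.adjoint Y) (Y ψ)), norm_nonneg ψ]
  have h3 : ‖(ContinuousLinearMap.adjoint Y) (Y ψ) - ψ‖ = 0 := by
    nlinarith [norm_nonneg ((ContinuousLinearMap.adjoint Y) (Y ψ) - ψ)]
  exact sub_eq_zero.1 (norm_eq_zero.1 h3)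

/-- If `Y` is a contraction on `H` which maps `(T - z̄) f` to `(T - z) f` and `T` is densely
defined, then `I - Y` is injective. -/
theorem one_sub_injective {T : H →ₗ.[ℂ] H} (hd : Dense (T.domain : Set H)) {z : ℂ}
    (hz : 0 < z.im) {Y : H →L[ℂ] H} (hY : ∀ x, ‖Y x‖ ≤ ‖x‖)
    (hYT : ∀ f : T.domain, Y (shift T (conj z) f) = shift T z f) :
    Function.Injective (1 - Y : H →L[ℂ] H) := by
  rw [injective_iff_map_eq_zero]
  intro x hx
  have hx' : Y x = x := by
    have : x - Y x = 0 := by simpa using hx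
    exact (sub_eq_zero.1 this).symm
  have hadj : (ContinuousLinearMap.adjoint Y) x = x := by
    have := adjoint_apply_of_norm_eq hY (ψ := x) (by rw [hx'])
    rwa [hx'] at this
  refine hd.eq_zero_of_inner_left (𝕜 := ℂ) fun f hf => ?_
  have h1 : inner ℂ x ((z - conj z) • f) = 0 := by
    have hs := shift_conj_sub T z ⟨f, hf⟩
    rw [← hYT ⟨f, hf⟩] at hs
    rw [← hs, inner_sub_right,
      ← ContinuousLinearMap.adjoint_inner_left, hadj, sub_self]
  rw [inner_smul_right] at h1
  exact (mul_eq_zero.1 h1).resolve_left (sub_conj_ne_zero hz)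

/-- The operator with Cayley transform `Y`: `(I - Y) h ↦ (z I - z̄ Y) h`. -/
def ofCayley (z : ℂ) (Y : H →L[ℂ] H) (hinj : Function.Injective (1 - Y : H →L[ℂ] H)) :
    H →ₗ.[ℂ] H where
  domain := LinearMap.range (1 - Y : H →L[ℂ] H).toLinearMap
  toFun := (z • (1 : H →L[ℂ] H) - conj z • Y).toLinearMap ∘ₗ
    (LinearEquiv.ofInjective (1 - Y : H →L[ℂ] H).toLinearMap hinj).symm.toLinearMap

theorem ofCayley_apply (z : ℂ) (Y : H →L[ℂ] H)
    (hinj : Function.Injective (1 - Y : H →L[ℂ] H)) (h : H)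
    (f : (ofCayley z Y hinj).domain) (hf : (f : H) = h - Y h) :
    ofCayley z Y hinj f = z • h - conj z • Y h := by
  have hf' : f = LinearEquiv.ofInjective (1 - Y : H →L[ℂ] H).toLinearMap hinj h := by
    apply Subtype.ext
    rw [hf, LinearEquiv.ofInjective_apply]
    simp
  subst hf'
  change (z • (1 : H →L[ℂ] H) - conj z • Y).toLinearMap
    ((LinearEquiv.ofInjective (1 - Y : H →L[ℂ] H).toLinearMap hinj).symm _) = _
  rw [LinearEquiv.symm_apply_apply]
  simp

theorem ofCayley_dissipative {z : ℂ} (hz : 0 < z.im) {Y : H →L[ℂ] H}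
    (hY : ∀ x, ‖Y x‖ ≤ ‖x‖) (hinj : Function.Injective (1 - Y : H →L[ℂ] H)) :
    IsDissipative (ofCayley z Y hinj) := by
  intro f
  obtain ⟨h, hh⟩ := f.2
  have hf : (f : H) = h - Y h := by rw [← hh]; simp
  have h3 : ‖Y h‖ ^ 2 ≤ ‖h‖ ^ 2 := by
    have := hY h
    gcongr
  rw [ofCayley_apply z Y hinj h f hf, hf, inner_sub_left, inner_sub_right, inner_sub_right,
    inner_smul_right, inner_smul_right, inner_smul_right, inner_smul_right,
    inner_self_eq_norm_sq_to_K, inner_self_eq_norm_sq_to_K, ← inner_conj_symm (Y h) h]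
  have h4 : 0 ≤ z.im * (‖h‖ ^ 2 - ‖Y h‖ ^ 2) := mul_nonneg hz.le (by linarith)
  have e1 : (((‖h‖ : ℂ)) ^ 2) = ((‖h‖ ^ 2 : ℝ) : ℂ) := by push_cast; rfl
  have e2 : (((‖Y h‖ : ℂ)) ^ 2) = ((‖Y h‖ ^ 2 : ℝ) : ℂ) := by push_cast; rfl
  simp only [Complex.coe_algebraMap, e1, e2]
  simp only [Complex.sub_im, Complex.mul_im, Complex.conj_re, Complex.conj_im,
    Complex.ofReal_re, Complex.ofReal_im]
  linarith

/-- For maximal dissipative `T` and `Im z > 0` the operator `T - z̄ I` maps `dom T` onto `H`. -/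
theorem shift_surjective {T : H →ₗ.[ℂ] H} (hT : IsMaximalDissipative T) {z : ℂ}
    (hz : 0 < z.im) : Function.Surjective (shift T (conj z)) := by
  let R := (LinearMap.range (shift T (conj z))).topologicalClosure
  let e : T.domain →ₗ[ℂ] R := (shift T (conj z)).codRestrict R
    fun f => Submodule.le_topologicalClosure _ (LinearMap.mem_range_self _ f)
  have hbound : ∀ f, ‖shift T z f‖ ≤ 1 * ‖e f‖ := fun f => norm_shift_le hT.dissipative hz f
  have hdense : DenseRange e := by
    intro x
    rw [closure_subtype]
    have hx : (x : H) ∈ closure ((LinearMap.range (shift T (conj z)) : Submodule ℂ H) : Set H) := by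
      rw [← Submodule.topologicalClosure_coe]
      exact x.2
    refine closure_mono ?_ hx
    rintro _ ⟨f, rfl⟩
    exact ⟨e f, ⟨f, rfl⟩, rfl⟩
  have : CompleteSpace R :=
    (Submodule.isClosed_topologicalClosure _).completeSpace_coe
  let Y : H →L[ℂ] H := ((shift T z).extendOfNorm e) ∘L R.orthogonalProjectionOnto
  have hY : ∀ x, ‖Y x‖ ≤ ‖x‖ := by
    intro x
    calc ‖Y x‖ ≤ 1 * ‖R.orthogonalProjectionOnto x‖ :=
          LinearMap.norm_extendOfNorm_apply_le hdense 1 hbound _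
      _ ≤ ‖x‖ := by
          rw [one_mul]
          exact R.norm_orthogonalProjectionOnto_apply_le x
  have hYT : ∀ f : T.domain, Y (shift T (conj z) f) = shift T z f := by
    intro f
    have h1 : R.orthogonalProjectionOnto (shift T (conj z) f) = e f :=
      R.orthogonalProjectionOnto_mem_subspace_eq_self (e f)
    change (shift T z).extendOfNorm e (R.orthogonalProjectionOnto (shift T (conj z) f)) = _
    rw [h1]
    exact LinearMap.extendOfNorm_eq hdense ⟨1, hbound⟩ f
  have hinj := one_sub_injective hT.dense_domain hz hY hYT
  have hne := sub_conj_ne_zero hz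
  have hrep : ∀ f : T.domain, (f : H) = (z - conj z)⁻¹ • shift T (conj z) f
      - Y ((z - conj z)⁻¹ • shift T (conj z) f) := by
    intro f
    rw [map_smul, hYT, ← smul_sub, shift_conj_sub, inv_smul_smul₀ hne]
  have hle : T ≤ ofCayley z Y hinj := by
    refine ⟨fun f hf => ⟨(z - conj z)⁻¹ • shift T (conj z) ⟨f, hf⟩, ?_⟩, ?_⟩
    · exact (hrep ⟨f, hf⟩).symm
    · intro f g hfg
      rw [ofCayley_apply z Y hinj ((z - conj z)⁻¹ • shift T (conj z) f) g
        (by rw [← hfg]; exact hrep f), map_smul, hYT, smul_comm z, smul_comm (conj z),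
        ← smul_sub, eq_inv_smul_iff₀ hne, shift_apply, shift_apply]
      module
  have heq := hT.maximal _ (ofCayley_dissipative hz hY hinj) hle
  intro h
  have hmem : h - Y h ∈ (ofCayley z Y hinj).domain := ⟨h, by simp⟩
  have hval : shift (ofCayley z Y hinj) (conj z) ⟨h - Y h, hmem⟩ = (z - conj z) • h := by
    rw [shift_apply, ofCayley_apply z Y hinj h _ rfl]
    module
  have hex : ∃ g : (ofCayley z Y hinj).domain,
      shift (ofCayley z Y hinj) (conj z) g = h := by
    refine ⟨(z - conj z)⁻¹ • ⟨h - Y h, hmem⟩, ?_⟩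
    rw [map_smul, hval, inv_smul_smul₀ hne]
  rw [heq] at hex
  exact hex

/-- The Cayley transform `Y_z = (T - z I)(T - z̄ I)⁻¹`, `Im z > 0`, an everywhere defined
contraction. -/
def cayley {T : H →ₗ.[ℂ] H} (hT : IsMaximalDissipative T) {z : ℂ} (hz : 0 < z.im) :
    H →L[ℂ] H :=
  (shift T z ∘ₗ (LinearEquiv.ofBijective (shift T (conj z))
    ⟨shift_injective hT.dissipative hz, shift_surjective hT hz⟩).symm.toLinearMap).mkContinuous 1
    (by
      intro x
      obtain ⟨f, rfl⟩ := (LinearEquiv.ofBijective (shift T (conj z))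
        ⟨shift_injective hT.dissipative hz, shift_surjective hT hz⟩).surjective x
      rw [LinearMap.comp_apply, LinearEquiv.coe_coe, LinearEquiv.symm_apply_apply]
      exact norm_shift_le hT.dissipative hz f)

theorem cayley_shift {T : H →ₗ.[ℂ] H} (hT : IsMaximalDissipative T) {z : ℂ} (hz : 0 < z.im)
    (f : T.domain) : cayley hT hz (shift T (conj z) f) = shift T z f := by
  have h := (LinearEquiv.ofBijective (shift T (conj z))
    ⟨shift_injective hT.dissipative hz, shift_surjective hT hz⟩).symm_apply_apply f
  exact congrArg (shift T z) h

theorem norm_cayley_le {T : H →ₗ.[ℂ] H} (hT : IsMaximalDissipative T) {z : ℂ} (hz : 0 < z.im)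
    (x : H) : ‖cayley hT hz x‖ ≤ ‖x‖ := by
  obtain ⟨f, rfl⟩ := shift_surjective hT hz x
  rw [cayley_shift]
  simpa using norm_shift_le hT.dissipative hz f

end Complete

/-- The Hermitian domain `S_T = ker γ_T = {f ∈ dom T : Im (T f, f) = 0}`; it is a linear manifold
because `γ_T` is a nonnegative quadratic form. -/
def hermitianDomain (T : H →ₗ.[ℂ] H) (hT : IsDissipative T) : Submodule ℂ H where
  carrier := {f | ∃ h : f ∈ T.domain, gammaForm T ⟨f, h⟩ = 0}
  zero_mem' := ⟨T.domain.zero_mem, by simp [gammaForm]⟩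
  smul_mem' := by
    rintro c f ⟨hf, h0⟩
    refine ⟨T.domain.smul_mem c hf, ?_⟩
    have h1 : T ⟨c • f, T.domain.smul_mem c hf⟩ = c • T ⟨f, hf⟩ := T.map_smul c ⟨f, hf⟩
    simp only [gammaForm] at h0 ⊢
    rw [h1, inner_smul_left, inner_smul_right, ← mul_assoc, mul_comm (conj c) c,
      Complex.mul_conj]
    simp [h0]
  add_mem' := by
    rintro f g ⟨hf, hf0⟩ ⟨hg, hg0⟩
    refine ⟨T.domain.add_mem hf hg, ?_⟩
    have h1 : T ⟨f + g, T.domain.add_mem hf hg⟩ = T ⟨f, hf⟩ + T ⟨g, hg⟩ :=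
      T.map_add ⟨f, hf⟩ ⟨g, hg⟩
    have h2 : T ⟨f - g, T.domain.sub_mem hf hg⟩ = T ⟨f, hf⟩ - T ⟨g, hg⟩ :=
      T.map_sub ⟨f, hf⟩ ⟨g, hg⟩
    have p1 := hT ⟨f + g, T.domain.add_mem hf hg⟩
    have p2 := hT ⟨f - g, T.domain.sub_mem hf hg⟩
    simp only [gammaForm] at hf0 hg0 ⊢
    rw [h1] at p1 ⊢
    rw [h2] at p2
    simp only [inner_add_left, inner_add_right, inner_sub_left, inner_sub_right,
      Complex.add_im, Complex.sub_im] at p1 p2 hf0 hg0 ⊢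
    linarith

/-- The Hermitian part `S = T ↾ S_T` of `T`. -/
def hermitianPart (T : H →ₗ.[ℂ] H) (hT : IsDissipative T) : H →ₗ.[ℂ] H :=
  T.domRestrict (hermitianDomain T hT)

/-- `N_z = M_{z̄}ᗮ`, where `M_w = ran (S - w I)`; for a symmetric operator `S` and `Im z ≠ 0` this
is the deficiency subspace. -/
abbrev deficiencySubspace (S : H →ₗ.[ℂ] H) (z : ℂ) : Submodule ℂ H :=
  (LinearMap.range (shift S (conj z)))ᗮ

variable [CompleteSpace H]

/-- `Y_z` maps `N_z` into `N_{z̄}` (deficiency subspaces of the Hermitian part). -/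
theorem cayley_mem_deficiencySubspace {T : H →ₗ.[ℂ] H} (hT : IsMaximalDissipative T) {z : ℂ}
    (hz : 0 < z.im) (x : deficiencySubspace (hermitianPart T hT.dissipative) z) :
    cayley hT hz (x : H) ∈
      deficiencySubspace (hermitianPart T hT.dissipative) (conj z) := by
  rw [Submodule.mem_orthogonal]
  rintro _ ⟨f, rfl⟩
  obtain ⟨hfd, hf0⟩ := f.2.1
  have hS : ∀ w, shift (hermitianPart T hT.dissipative) w f = shift T w ⟨f, hfd⟩ :=
    fun w => rfl
  have hnorm : ‖cayley hT hz (shift T (conj z) ⟨f, hfd⟩)‖ = ‖shift T (conj z) ⟨f, hfd⟩‖ := by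
    rw [cayley_shift]
    have h := norm_shift_sq T z ⟨f, hfd⟩
    simp only [gammaForm] at hf0
    rw [hf0, mul_zero, sub_eq_zero] at h
    exact ((sq_eq_sq₀ (norm_nonneg _) (norm_nonneg _)).1 h).symm
  have hx := (Submodule.mem_orthogonal _ _).1 x.2 _
    (LinearMap.mem_range_self (shift (hermitianPart T hT.dissipative) (conj z)) f)
  rw [hS] at hx
  rw [hS, Complex.conj_conj, ← cayley_shift hT hz, ← ContinuousLinearMap.adjoint_inner_left,
    adjoint_apply_of_norm_eq (norm_cayley_le hT hz) hnorm, hx]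

/-- `M_z = Y_z ↾ N_z : N_z → N_{z̄}`. -/
def cayleyRestrict {T : H →ₗ.[ℂ] H} (hT : IsMaximalDissipative T) {z : ℂ} (hz : 0 < z.im) :
    deficiencySubspace (hermitianPart T hT.dissipative) z →L[ℂ]
      deficiencySubspace (hermitianPart T hT.dissipative) (conj z) :=
  (cayley hT hz ∘L (deficiencySubspace (hermitianPart T hT.dissipative) z).subtypeL).codRestrict
    (deficiencySubspace (hermitianPart T hT.dissipative) (conj z))
    (cayley_mem_deficiencySubspace hT hz)

/-- The defect operator `D_Z = (I - Z* Z)^{1/2}` of a contraction `Z`. -/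
def defectOp {E F : Type*} [NormedAddCommGroup E] [InnerProductSpace ℂ E] [CompleteSpace E]
    [NormedAddCommGroup F] [InnerProductSpace ℂ F] [CompleteSpace F] (Z : E →L[ℂ] F) :
    E →L[ℂ] E :=
  CFC.sqrt (1 - ContinuousLinearMap.adjoint Z ∘L Z)

end DissipativeOp

end

open DissipativeOp

/-!
Write `Y = Y_z` for the Cayley transform of `T`, `M = M_z`, `D_M` for the defect operator of `M`,
and `h = (T - z̄ I) f`. Then `(z - z̄) f = (I - Y) h`, and since `Y` is isometric on the orthogonal
complement of `𝔑_z` and maps it and `𝔑_z` into mutually orthogonal subspaces,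
`4 Im z γ_T[f] = ‖h‖² - ‖Y h‖² = ‖D_M P_{𝔑_z} h‖²` (`norm_defectOp_proj_sq`). So `γ_T` is singular
exactly when the closure of `{((I - Y) h, D_M P_{𝔑_z} h)}` contains `{0} × ran D_M`. Taking
orthogonal complements in `H × 𝔑_z` (`forall_exists_seq_iff_adjoint`), this says that
`ran (I - Y*) ∩ ran D_M = {0}`.

If `(I - Y*) a` lies in `ran D_M ⊆ 𝔑_z`, then `a` is orthogonal to `𝔖_T`, and for such `a` one has
`(I - Y*) a = P_{𝔑_z} a - M* P_{𝔑_z̄} a` and `(I - Y) a = P_{𝔑_z̄} a - M P_{𝔑_z} a`. As `I - Y` and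
`I - Y*` are injective, the first identity gives the criterion with `D_M`
(`dSing_iff_forall_orthogonal`). The criterion with `D_{M*}` follows because
`x - M* y ∈ ran D_M` if and only if `y - M x ∈ ran D_{M*}`
(`sub_adjoint_apply_mem_range_defectOp_iff`); this rests on `M ran D_M ⊆ ran D_{M*}`, which is proved
with Douglas' range criterion.

When `‖M‖ < 1` the operator `D_M` is onto, so singularity forces `𝔖_Tᗮ = {0}`. The operators `M` and
`M*` strictly decrease the norm of nonzero vectors, so `‖M‖ = ‖M*‖ < 1` as soon as `𝔑_z` or `𝔑_z̄`
is finite-dimensional; hence the infinite deficiency indices.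

Finally, for `f ∈ dom T ∩ dom T*` the sesquilinear form `γ_T(f, ·)` is continuous in the norm of `H`,
so `γ_T[f] ≤ lim (γ_T[f - u_n] + Im (u_n, T* f - T f)) = 0` along an approximating sequence `u_n`.
-/

namespace DissipativeOp

open ContinuousLinearMap Filter Topology

variable {E F G : Type*} [NormedAddCommGroup E] [InnerProductSpace ℂ E] [CompleteSpace E]
  [NormedAddCommGroup F] [InnerProductSpace ℂ F] [CompleteSpace F]
  [NormedAddCommGroup G] [InnerProductSpace ℂ G] [CompleteSpace G]

/-! ### Defect operators of contractions -/

theorem isSelfAdjoint_defectOp (Z : E →L[ℂ] F) : IsSelfAdjoint (defectOp Z) :=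
  IsSelfAdjoint.of_nonneg (CFC.sqrt_nonneg _)

theorem inner_defectOp_left (Z : E →L[ℂ] F) (x y : E) :
    inner ℂ (defectOp Z x) y = inner ℂ x (defectOp Z y) := by
  conv_lhs => rw [← (isSelfAdjoint_defectOp Z).adjoint_eq, adjoint_inner_left]

theorem defectOp_defectOp {Z : E →L[ℂ] F} (hZ : ‖Z‖ ≤ 1) (x : E) :
    defectOp Z (defectOp Z x) = x - adjoint Z (Z x) := by
  have hpos : (0 : E →L[ℂ] E) ≤ 1 - adjoint Z ∘L Z := by
    rw [ContinuousLinearMap.nonneg_iff_isPositive]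
    refine ⟨?_, fun x => ?_⟩
    · intro x y
      simp [inner_sub_left, inner_sub_right, adjoint_inner_left, adjoint_inner_right]
    · have h : ‖Z x‖ ≤ 1 * ‖x‖ := Z.le_of_opNorm_le hZ x
      rw [one_mul] at h
      have h2 : ‖Z x‖ ^ 2 ≤ ‖x‖ ^ 2 := by gcongr
      have h1 : (1 : E →L[ℂ] E) x = x := rfl
      simp only [reApplyInnerSelf, sub_apply, h1, comp_apply, inner_sub_left,
        adjoint_inner_left, map_sub, inner_self_eq_norm_sq]
      linarith
  have h := CFC.sqrt_mul_sqrt_self _ hpos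
  simpa [defectOp] using congrArg (fun A : E →L[ℂ] E => A x) h

theorem norm_defectOp_sq {Z : E →L[ℂ] F} (hZ : ‖Z‖ ≤ 1) (x : E) :
    ‖defectOp Z x‖ ^ 2 = ‖x‖ ^ 2 - ‖Z x‖ ^ 2 := by
  rw [← inner_self_eq_norm_sq (𝕜 := ℂ), inner_defectOp_left, defectOp_defectOp hZ, inner_sub_right,
    adjoint_inner_right, map_sub, inner_self_eq_norm_sq, inner_self_eq_norm_sq]

/-- Douglas' range criterion for a self-adjoint operator. -/
theorem mem_range_iff_exists_bound {A : E →L[ℂ] E} (hA : IsSelfAdjoint A) (v : E) :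
    v ∈ LinearMap.range A.toLinearMap ↔ ∃ C : ℝ, ∀ h, ‖inner ℂ v h‖ ≤ C * ‖A h‖ := by
  have hsymm : ∀ x y, inner ℂ (A x) y = inner ℂ x (A y) := fun x y => by
    conv_lhs => rw [← hA.adjoint_eq, adjoint_inner_left]
  constructor
  · rintro ⟨u, rfl⟩
    refine ⟨‖u‖, fun h => ?_⟩
    change ‖inner ℂ (A u) h‖ ≤ _
    rw [hsymm]
    exact norm_inner_le_norm _ _
  · rintro ⟨C, hC⟩
    -- the functional `A h ↦ ⟪v, h⟫` is bounded on the range of `A`; it is extended by continuity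
    -- to the closure `R` and represented there by a vector
    let R := (LinearMap.range A.toLinearMap).topologicalClosure
    let e : E →ₗ[ℂ] R := A.toLinearMap.codRestrict R
      fun f => Submodule.le_topologicalClosure _ (LinearMap.mem_range_self _ f)
    have hbound : ∀ h, ‖(innerSL ℂ v).toLinearMap h‖ ≤ C * ‖e h‖ := hC
    have hdense : DenseRange e := by
      intro x
      rw [closure_subtype]
      have hx : (x : E) ∈ closure ((LinearMap.range A.toLinearMap : Submodule ℂ E) : Set E) := by
        rw [← Submodule.topologicalClosure_coe]
        exact x.2
      refine closure_mono ?_ hx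
      rintro _ ⟨f, rfl⟩
      exact ⟨e f, ⟨f, rfl⟩, rfl⟩
    have : CompleteSpace R :=
      (Submodule.isClosed_topologicalClosure _).completeSpace_coe
    let φ : R →L[ℂ] ℂ := (innerSL ℂ v).toLinearMap.extendOfNorm e
    have hφ : ∀ h, φ (e h) = inner ℂ v h := fun h =>
      LinearMap.extendOfNorm_eq hdense ⟨C, hbound⟩ h
    let u : R := (InnerProductSpace.toDual ℂ R).symm φ
    refine ⟨(u : E), ext_inner_right ℂ fun h => ?_⟩
    change inner ℂ (A u) h = _
    rw [hsymm, ← hφ, ← InnerProductSpace.toDual_symm_apply]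
    rfl

theorem mem_range_defectOp_iff (Z : E →L[ℂ] F) (v : E) :
    v ∈ LinearMap.range (defectOp Z).toLinearMap ↔
      ∃ C : ℝ, ∀ h, ‖inner ℂ v h‖ ≤ C * ‖defectOp Z h‖ :=
  mem_range_iff_exists_bound (isSelfAdjoint_defectOp Z) v

theorem norm_adjoint_le_one {Z : E →L[ℂ] F} (hZ : ‖Z‖ ≤ 1) : ‖adjoint Z‖ ≤ 1 := by
  rwa [LinearIsometryEquiv.norm_map]

theorem norm_defectOp_adjoint_apply_le {Z : E →L[ℂ] F} (hZ : ‖Z‖ ≤ 1) (g : F) :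
    ‖defectOp Z (adjoint Z g)‖ ≤ ‖defectOp (adjoint Z) g‖ := by
  refine abs_le_of_sq_le_sq' ?_ (norm_nonneg _) |>.2
  rw [norm_defectOp_sq hZ, norm_defectOp_sq (norm_adjoint_le_one hZ)]
  have h1 : ‖adjoint Z g‖ ^ 2 ≤ ‖Z (adjoint Z g)‖ * ‖g‖ := by
    rw [← inner_self_eq_norm_sq (𝕜 := ℂ), adjoint_inner_right]
    exact (RCLike.re_le_norm _).trans (norm_inner_le_norm _ _)
  nlinarith [sq_nonneg (‖Z (adjoint Z g)‖ - ‖g‖)]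

/-- `Z` maps `ran D_Z` into `ran D_{Z*}`: the range form of `Z D_Z = D_{Z*} Z`. -/
theorem apply_mem_range_defectOp_adjoint {Z : E →L[ℂ] F} (hZ : ‖Z‖ ≤ 1) {v : E}
    (hv : v ∈ LinearMap.range (defectOp Z).toLinearMap) :
    Z v ∈ LinearMap.range (defectOp (adjoint Z)).toLinearMap := by
  obtain ⟨u, rfl⟩ := hv
  rw [mem_range_defectOp_iff]
  refine ⟨‖u‖, fun g => ?_⟩
  change ‖inner ℂ (Z (defectOp Z u)) g‖ ≤ _
  rw [← adjoint_inner_right, inner_defectOp_left]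
  exact (norm_inner_le_norm _ _).trans
    (mul_le_mul_of_nonneg_left (norm_defectOp_adjoint_apply_le hZ g) (norm_nonneg _))

/-- `y - Z x = D_{Z*}² y - Z (x - Z* y)`, and `Z` maps `ran D_Z` into `ran D_{Z*}`. -/
theorem sub_apply_mem_range_defectOp_adjoint {Z : E →L[ℂ] F} (hZ : ‖Z‖ ≤ 1) {x : E} {y : F}
    (h : x - adjoint Z y ∈ LinearMap.range (defectOp Z).toLinearMap) :
    y - Z x ∈ LinearMap.range (defectOp (adjoint Z)).toLinearMap := by
  have h1 : y - Z (adjoint Z y) ∈ LinearMap.range (defectOp (adjoint Z)).toLinearMap := by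
    refine ⟨defectOp (adjoint Z) y, ?_⟩
    simpa using defectOp_defectOp (norm_adjoint_le_one hZ) y
  have h2 := sub_mem h1 (apply_mem_range_defectOp_adjoint hZ h)
  have e : y - Z x = y - Z (adjoint Z y) - Z (x - adjoint Z y) := by
    rw [map_sub]; abel
  rwa [e]

theorem sub_adjoint_apply_mem_range_defectOp_iff {Z : E →L[ℂ] F} (hZ : ‖Z‖ ≤ 1) {x : E} {y : F} :
    x - adjoint Z y ∈ LinearMap.range (defectOp Z).toLinearMap ↔
      y - Z x ∈ LinearMap.range (defectOp (adjoint Z)).toLinearMap := by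
  refine ⟨sub_apply_mem_range_defectOp_adjoint hZ, fun h => ?_⟩
  have := sub_apply_mem_range_defectOp_adjoint (Z := adjoint Z) (norm_adjoint_le_one hZ)
    (x := y) (y := x) (by rwa [adjoint_adjoint])
  rwa [adjoint_adjoint] at this

theorem range_defectOp_eq_top {Z : E →L[ℂ] F} (hZ : ‖Z‖ < 1) :
    LinearMap.range (defectOp Z).toLinearMap = ⊤ := by
  rw [eq_top_iff]
  rintro v -
  rw [mem_range_defectOp_iff]
  have hc : 0 < 1 - ‖Z‖ ^ 2 := by nlinarith [norm_nonneg Z]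
  have hs : 0 < √(1 - ‖Z‖ ^ 2) := Real.sqrt_pos.2 hc
  refine ⟨‖v‖ * (√(1 - ‖Z‖ ^ 2))⁻¹, fun h => (norm_inner_le_norm _ _).trans ?_⟩
  rw [mul_assoc]
  refine mul_le_mul_of_nonneg_left ?_ (norm_nonneg _)
  rw [le_inv_mul_iff₀ hs]
  refine abs_le_of_sq_le_sq' ?_ (norm_nonneg _) |>.2
  rw [norm_defectOp_sq hZ.le, mul_pow, Real.sq_sqrt hc.le]
  have h2 : ‖Z h‖ ^ 2 ≤ (‖Z‖ * ‖h‖) ^ 2 := by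
    gcongr
    exact Z.le_opNorm h
  linarith

/-- Compactness of the unit sphere: a linear map which strictly decreases the norm of nonzero
vectors of a finite-dimensional space has norm less than one. -/
theorem norm_lt_one_of_finiteDimensional {E F : Type*} [NormedAddCommGroup E]
    [InnerProductSpace ℂ E] [NormedAddCommGroup F] [InnerProductSpace ℂ F] [FiniteDimensional ℂ E]
    {Z : E →L[ℂ] F} (hZ : ∀ x, x ≠ 0 → ‖Z x‖ < ‖x‖) : ‖Z‖ < 1 := by
  rcases subsingleton_or_nontrivial E with hE | hE
  · have : Z = 0 := by
      ext x
      rw [Subsingleton.elim x 0, map_zero, map_zero]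
    simp [this]
  have : ProperSpace E := FiniteDimensional.proper ℂ E
  obtain ⟨x₀, hx₀, hmax⟩ := (isCompact_sphere (0 : E) 1).exists_isMaxOn
    ((NormedSpace.sphere_nonempty (E := E)).2 zero_le_one) (f := fun x => ‖Z x‖) (by fun_prop)
  have hn : ‖x₀‖ = 1 := by simpa using hx₀
  have h1 : ‖Z x₀‖ < 1 := hn ▸ hZ x₀ (by rintro rfl; simp at hn)
  refine lt_of_le_of_lt (Z.opNorm_le_of_unit_norm (norm_nonneg _) fun x hx => ?_) h1
  exact hmax (by simpa using hx)

theorem norm_adjoint_apply_lt {Z : E →L[ℂ] F} (hZ : ∀ x, x ≠ 0 → ‖Z x‖ < ‖x‖) {y : F}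
    (hy : y ≠ 0) : ‖adjoint Z y‖ < ‖y‖ := by
  by_cases h0 : adjoint Z y = 0
  · rw [h0, norm_zero]
    exact norm_pos_iff.2 hy
  have h1 : ‖adjoint Z y‖ ^ 2 ≤ ‖Z (adjoint Z y)‖ * ‖y‖ := by
    rw [← inner_self_eq_norm_sq (𝕜 := ℂ), adjoint_inner_right]
    exact (RCLike.re_le_norm _).trans (norm_inner_le_norm _ _)
  have h2 := hZ _ h0
  have h3 : 0 < ‖adjoint Z y‖ := norm_pos_iff.2 h0
  have h4 : 0 < ‖y‖ := norm_pos_iff.2 hy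
  nlinarith

/-! ### Singularity of one bounded operator relative to another -/

/-- The closure of the relation `{(A h, B h)}` contains `{0} × ran B` if and only if
`ran A* ∩ ran B* = {0}`. -/
theorem forall_exists_seq_iff_adjoint (A : E →L[ℂ] F) (B : E →L[ℂ] G) :
    (∀ h, ∃ u : ℕ → E, Tendsto (fun n => A (u n)) atTop (𝓝 0) ∧
      Tendsto (fun n => B (h - u n)) atTop (𝓝 0)) ↔
    ∀ a b, adjoint A a = adjoint B b → adjoint B b = 0 := by
  constructor
  · intro H a b hab
    refine ext_inner_right ℂ fun h => ?_
    obtain ⟨u, hu, hv⟩ := H h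
    have h1 : Tendsto (fun n => inner ℂ b (B (h - u n)) + inner ℂ a (A (u n))) atTop
        (𝓝 (inner ℂ b 0 + inner ℂ a 0)) :=
      (tendsto_const_nhds.inner hv).add (tendsto_const_nhds.inner hu)
    have h2 : ∀ n, inner ℂ b (B (h - u n)) + inner ℂ a (A (u n)) = inner ℂ (adjoint B b) h := by
      intro n
      rw [← adjoint_inner_left, ← adjoint_inner_left, hab, inner_sub_right]
      ring
    simp only [h2, inner_zero_right, add_zero] at h1
    rw [inner_zero_left]
    exact tendsto_nhds_unique tendsto_const_nhds h1
  · intro H h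
    -- `(0, B h)` lies in `(ran J)ᗮᗮ`, the closure of `ran J = {(A x, B x)}`: a vector `(a, b)` of
    -- `(ran J)ᗮ` satisfies `A* (-a) = B* b`, so `B* b = 0`
    let e := (WithLp.prodContinuousLinearEquiv 2 ℂ F G).symm
    let J : E →L[ℂ] WithLp 2 (F × G) := e.toContinuousLinearMap ∘L A.prod B
    have hJ : ∀ x, J x = WithLp.toLp 2 (A x, B x) := fun x => rfl
    have hmem : WithLp.toLp 2 ((0 : F), B h) ∈
        closure ((LinearMap.range J.toLinearMap : Submodule ℂ _) : Set (WithLp 2 (F × G))) := by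
      rw [← Submodule.topologicalClosure_coe, ← Submodule.orthogonal_orthogonal_eq_closure]
      intro w hw
      have hw' : ∀ x, inner ℂ (A x) w.fst + inner ℂ (B x) w.snd = 0 := fun x => by
        have := hw (J x) (LinearMap.mem_range_self _ x)
        rwa [hJ, WithLp.prod_inner_apply] at this
      have h0 : adjoint A (-w.fst) = adjoint B w.snd := by
        refine ext_inner_left ℂ fun x => ?_
        rw [adjoint_inner_right, adjoint_inner_right, inner_neg_right]
        exact neg_eq_of_add_eq_zero_right (hw' x)
      have h1 := H _ _ h0
      rw [WithLp.prod_inner_apply]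
      change inner ℂ w.fst 0 + inner ℂ w.snd (B h) = 0
      rw [← adjoint_inner_left, h1, inner_zero_right, inner_zero_left, add_zero]
    obtain ⟨s, hs, hlim⟩ := mem_closure_iff_seq_limit.1 hmem
    choose u hu using hs
    have hlim' : Tendsto (fun n => (A (u n), B (u n))) atTop (𝓝 ((0 : F), B h)) := by
      have := ((WithLp.prodContinuousLinearEquiv 2 ℂ F G).continuous.tendsto _).comp hlim
      refine this.congr fun n => ?_
      rw [Function.comp_apply, ← hu n]
      rfl
    refine ⟨u, (continuous_fst.tendsto _).comp hlim', ?_⟩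
    have h2 := (tendsto_const_nhds (x := B h)).sub ((continuous_snd.tendsto _).comp hlim')
    rw [sub_self] at h2
    exact h2.congr fun n => by simp

variable {H : Type*} [NormedAddCommGroup H] [InnerProductSpace ℂ H] {T : H →ₗ.[ℂ] H}

/-- The deficiency subspace `𝔑_z` of the Hermitian part of `T`. -/
noncomputable abbrev hermitianDeficiency (hT : IsMaximalDissipative T) (z : ℂ) : Submodule ℂ H :=
  deficiencySubspace (hermitianPart T hT.dissipative) z

/-! ### Deficiency subspaces and the Cayley transform -/

section Cayley

variable (hT : IsMaximalDissipative T) {z : ℂ} (hz : 0 < z.im)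

theorem norm_shift_eq_iff_gammaForm_eq_zero {z : ℂ} (hz : 0 < z.im) (f : T.domain) :
    ‖shift T z f‖ = ‖shift T (conj z) f‖ ↔ gammaForm T f = 0 := by
  have h := norm_shift_sq T z f
  rw [← sq_eq_sq₀ (norm_nonneg _) (norm_nonneg _), eq_comm, ← sub_eq_zero, h, gammaForm]
  have : 4 * z.im ≠ 0 := by positivity
  simp [this]

theorem shift_mem_range_hermitianPart {f : T.domain} (hf : gammaForm T f = 0) (w : ℂ) :
    shift T w f ∈ LinearMap.range (shift (hermitianPart T hT.dissipative) w) :=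
  ⟨⟨f, ⟨f.2, hf⟩, f.2⟩, rfl⟩

theorem mem_hermitianDeficiency_iff {w : ℂ} {x : H} :
    x ∈ hermitianDeficiency hT w ↔
      ∀ f : T.domain, gammaForm T f = 0 → inner ℂ (shift T (conj w) f) x = 0 := by
  rw [Submodule.mem_orthogonal]
  constructor
  · exact fun h f hf => h _ (shift_mem_range_hermitianPart hT hf _)
  · rintro h _ ⟨f, rfl⟩
    obtain ⟨hfd, hf0⟩ := f.2.1
    exact h ⟨f, hfd⟩ hf0

theorem mem_hermitianDomain_orthogonal_iff {a : H} :
    a ∈ (hermitianDomain T hT.dissipative)ᗮ ↔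
      ∀ f : T.domain, gammaForm T f = 0 → inner ℂ (f : H) a = 0 := by
  rw [Submodule.mem_orthogonal]
  exact ⟨fun h f hf => h _ ⟨f.2, hf⟩, fun h f ⟨hfd, hf⟩ => h ⟨f, hfd⟩ hf⟩

variable [CompleteSpace H]

theorem adjoint_cayley_shift {f : T.domain} (hf : gammaForm T f = 0) :
    adjoint (cayley hT hz) (shift T z f) = shift T (conj z) f := by
  have := adjoint_apply_of_norm_eq (norm_cayley_le hT hz) (ψ := shift T (conj z) f)
    (by rw [cayley_shift]; exact (norm_shift_eq_iff_gammaForm_eq_zero hz f).2 hf)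
  rwa [cayley_shift] at this

theorem cayleyRestrict_apply (x : hermitianDeficiency hT z) :
    (cayleyRestrict hT hz x : H) = cayley hT hz x := rfl

theorem norm_cayleyRestrict_le : ‖cayleyRestrict hT hz‖ ≤ 1 :=
  opNorm_le_bound _ zero_le_one fun x => by
    rw [one_mul]
    exact norm_cayley_le hT hz x

/-- A vector `(T - z̄ I) f` whose norm is preserved by `Y_z` satisfies `γ_T[f] = 0`, so it lies in
`(T - z̄ I) 𝔖_T`, which is orthogonal to `𝔑_z`. -/
theorem norm_cayleyRestrict_apply_lt (x : hermitianDeficiency hT z) (hx : x ≠ 0) :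
    ‖cayleyRestrict hT hz x‖ < ‖x‖ := by
  refine lt_of_le_of_ne (norm_cayley_le hT hz x) fun h => hx ?_
  obtain ⟨f, hf⟩ := shift_surjective hT hz (x : H)
  have h1 : ‖cayley hT hz (x : H)‖ = ‖(x : H)‖ := h
  rw [← hf, cayley_shift, norm_shift_eq_iff_gammaForm_eq_zero hz] at h1
  have h2 := (mem_hermitianDeficiency_iff hT).1 x.2 f h1
  rw [hf, inner_self_eq_zero] at h2
  exact Subtype.ext h2

/-- On the orthogonal complement of `𝔑_z` the Cayley transform is isometric. -/
theorem adjoint_cayley_cayley_of_mem_orthogonal {k : H}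
    (hk : k ∈ (hermitianDeficiency hT z)ᗮ) :
    adjoint (cayley hT hz) (cayley hT hz k) = k := by
  have hcl : IsClosed {k : H | adjoint (cayley hT hz) (cayley hT hz k) = k} :=
    isClosed_eq (by fun_prop) continuous_id
  refine closure_minimal ?_ hcl (a := k) ?_
    (s := (LinearMap.range (shift (hermitianPart T hT.dissipative) (conj z)) : Set H))
  · rintro _ ⟨f, rfl⟩
    obtain ⟨hfd, hf0⟩ := f.2.1
    change adjoint (cayley hT hz) (cayley hT hz (shift T (conj z) ⟨f, hfd⟩)) =
      shift T (conj z) ⟨f, hfd⟩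
    rw [cayley_shift, adjoint_cayley_shift hT hz hf0]
  · rw [← Submodule.topologicalClosure_coe, ← Submodule.orthogonal_orthogonal_eq_closure]
    exact hk

/-- The form `γ_T` in terms of the Cayley transform. -/
theorem norm_defectOp_proj_sq (h : H) :
    ‖defectOp (cayleyRestrict hT hz) ((hermitianDeficiency hT z).orthogonalProjectionOnto h)‖ ^ 2
      = ‖h‖ ^ 2 - ‖cayley hT hz h‖ ^ 2 := by
  set n := (hermitianDeficiency hT z).orthogonalProjectionOnto h with hn
  have hk : h - n ∈ (hermitianDeficiency hT z)ᗮ :=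
    Submodule.sub_starProjection_mem_orthogonal h
  have hY := adjoint_cayley_cayley_of_mem_orthogonal hT hz hk
  have e1 : inner ℂ (h - n) (n : H) = 0 := Submodule.inner_left_of_mem_orthogonal n.2 hk
  have e2 : inner ℂ (cayley hT hz (h - n)) (cayley hT hz (n : H)) = 0 := by
    rw [← adjoint_inner_left, hY, e1]
  have e3 : ‖cayley hT hz (h - n)‖ * ‖cayley hT hz (h - n)‖ = ‖h - n‖ * ‖h - n‖ := by
    rw [← inner_self_eq_norm_mul_norm (𝕜 := ℂ), ← inner_self_eq_norm_mul_norm (𝕜 := ℂ),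
      ← adjoint_inner_left, hY]
  have p1 := norm_add_sq_eq_norm_sq_add_norm_sq_of_inner_eq_zero _ _ e1
  have p2 := norm_add_sq_eq_norm_sq_add_norm_sq_of_inner_eq_zero _ _ e2
  rw [← map_add] at p2
  rw [sub_add_cancel] at p1 p2
  have e4 : ‖cayleyRestrict hT hz n‖ = ‖cayley hT hz (n : H)‖ := rfl
  have e5 : ‖n‖ = ‖(n : H)‖ := rfl
  rw [norm_defectOp_sq (norm_cayleyRestrict_le hT hz), e4, e5]
  linarith

theorem sub_cayley_shift (f : T.domain) :
    shift T (conj z) f - cayley hT hz (shift T (conj z) f) = (z - conj z) • (f : H) := by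
  rw [cayley_shift, shift_conj_sub]

theorem eq_zero_of_cayley_eq {a : H} (h : cayley hT hz a = a) : a = 0 := by
  have hinj := one_sub_injective hT.dense_domain hz (norm_cayley_le hT hz) (cayley_shift hT hz)
  refine (injective_iff_map_eq_zero _).1 hinj a ?_
  simp [h]

theorem eq_zero_of_adjoint_cayley_eq {a : H} (h : adjoint (cayley hT hz) a = a) : a = 0 := by
  refine eq_zero_of_cayley_eq hT hz ?_
  -- a contraction and its adjoint have the same fixed vectors
  have hA : ∀ x, ‖adjoint (cayley hT hz) x‖ ≤ ‖x‖ := fun x => by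
    have h1 : ‖adjoint (cayley hT hz)‖ ≤ 1 := norm_adjoint_le_one
      (opNorm_le_bound _ zero_le_one fun x => by simpa using norm_cayley_le hT hz x)
    simpa using le_of_opNorm_le _ h1 x
  have := adjoint_apply_of_norm_eq hA (ψ := a) (by rw [h])
  rwa [h, adjoint_adjoint] at this

theorem adjoint_cayley_mem_hermitianDeficiency {v : H} (hv : v ∈ hermitianDeficiency hT (conj z)) :
    adjoint (cayley hT hz) v ∈ hermitianDeficiency hT z := by
  rw [mem_hermitianDeficiency_iff] at hv ⊢
  intro f hf
  rw [adjoint_inner_right, cayley_shift]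
  simpa using hv f hf

theorem adjoint_cayleyRestrict_apply (v : hermitianDeficiency hT (conj z)) :
    (adjoint (cayleyRestrict hT hz) v : H) = adjoint (cayley hT hz) v := by
  refine congrArg Subtype.val (a₂ := (⟨_, adjoint_cayley_mem_hermitianDeficiency hT hz v.2⟩ :
    hermitianDeficiency hT z)) (ext_inner_left ℂ fun n => ?_)
  rw [adjoint_inner_right, Submodule.coe_inner, Submodule.coe_inner, cayleyRestrict_apply,
    adjoint_inner_right]

/-- Both sides lie in `𝔑_{z̄}`, the left one because `a` is orthogonal to
`𝔖_T = (I - Y_z)(T - z̄ I) 𝔖_T`; their inner products with vectors of `𝔑_{z̄}` agree. -/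
theorem sub_cayley_eq_of_mem_orthogonal {a : H} (ha : a ∈ (hermitianDomain T hT.dissipative)ᗮ) :
    a - cayley hT hz a =
      ((hermitianDeficiency hT (conj z)).orthogonalProjectionOnto a -
        cayleyRestrict hT hz ((hermitianDeficiency hT z).orthogonalProjectionOnto a) :
        hermitianDeficiency hT (conj z)) := by
  have hmem : a - cayley hT hz a ∈ hermitianDeficiency hT (conj z) := by
    rw [mem_hermitianDeficiency_iff]
    intro f hf
    rw [Complex.conj_conj, inner_sub_right, ← adjoint_inner_left, adjoint_cayley_shift hT hz hf,
      ← inner_sub_left, ← neg_sub, shift_conj_sub, inner_neg_left, inner_smul_left,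
      (mem_hermitianDomain_orthogonal_iff hT).1 ha f hf, mul_zero, neg_zero]
  refine congrArg Subtype.val (a₁ := (⟨_, hmem⟩ : hermitianDeficiency hT (conj z)))
    (ext_inner_left ℂ fun v => ?_)
  rw [inner_sub_right, ← adjoint_inner_left (cayleyRestrict hT hz),
    Submodule.inner_orthogonalProjectionOnto_eq_of_mem_left,
    Submodule.inner_orthogonalProjectionOnto_eq_of_mem_left, adjoint_cayleyRestrict_apply,
    adjoint_inner_left, Submodule.coe_inner, inner_sub_right]

/-- Both sides lie in `𝔑_z`, and their inner products with vectors of `𝔑_z` agree. -/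
theorem sub_adjoint_cayley_eq_of_mem_orthogonal {a : H}
    (ha : a ∈ (hermitianDomain T hT.dissipative)ᗮ) :
    a - adjoint (cayley hT hz) a =
      ((hermitianDeficiency hT z).orthogonalProjectionOnto a -
        adjoint (cayleyRestrict hT hz)
          ((hermitianDeficiency hT (conj z)).orthogonalProjectionOnto a) :
        hermitianDeficiency hT z) := by
  have hmem : a - adjoint (cayley hT hz) a ∈ hermitianDeficiency hT z := by
    rw [mem_hermitianDeficiency_iff]
    intro f hf
    rw [inner_sub_right, adjoint_inner_right, ← inner_sub_left, sub_cayley_shift, inner_smul_left,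
      (mem_hermitianDomain_orthogonal_iff hT).1 ha f hf, mul_zero]
  refine congrArg Subtype.val (a₁ := (⟨_, hmem⟩ : hermitianDeficiency hT z))
    (ext_inner_left ℂ fun v => ?_)
  rw [inner_sub_right, adjoint_inner_right,
    Submodule.inner_orthogonalProjectionOnto_eq_of_mem_left,
    Submodule.inner_orthogonalProjectionOnto_eq_of_mem_left, cayleyRestrict_apply,
    ← adjoint_inner_right, Submodule.coe_inner, inner_sub_right]

/-- A vector `a` with `(I - Y_z*) a ∈ 𝔑_z` is orthogonal to `𝔖_T`. -/
theorem mem_orthogonal_of_sub_adjoint_cayley_mem {a : H}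
    (h : a - adjoint (cayley hT hz) a ∈ hermitianDeficiency hT z) :
    a ∈ (hermitianDomain T hT.dissipative)ᗮ := by
  rw [mem_hermitianDomain_orthogonal_iff hT]
  intro f hf
  have h1 := (mem_hermitianDeficiency_iff hT).1 h f hf
  rw [inner_sub_right, adjoint_inner_right, ← inner_sub_left, sub_cayley_shift,
    inner_smul_left] at h1
  exact (mul_eq_zero.1 h1).resolve_left ((map_ne_zero _).2 (sub_conj_ne_zero hz))

/-- For `a ⊥ 𝔖_T` the vector `P_{𝔑_z} a - M_z* P_{𝔑_z̄} a = (I - Y_z*) a` vanishes only if `a`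
does. -/
theorem proj_sub_adjoint_cayleyRestrict_eq_zero_iff {a : H}
    (ha : a ∈ (hermitianDomain T hT.dissipative)ᗮ) :
    (hermitianDeficiency hT z).orthogonalProjectionOnto a - adjoint (cayleyRestrict hT hz)
      ((hermitianDeficiency hT (conj z)).orthogonalProjectionOnto a) = 0 ↔ a = 0 := by
  refine ⟨fun h => eq_zero_of_adjoint_cayley_eq hT hz ?_, fun h => by simp [h]⟩
  have := sub_adjoint_cayley_eq_of_mem_orthogonal hT hz ha
  rw [h, Submodule.coe_zero, sub_eq_zero] at this
  exact this.symm

theorem proj_sub_cayleyRestrict_eq_zero_iff {a : H}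
    (ha : a ∈ (hermitianDomain T hT.dissipative)ᗮ) :
    (hermitianDeficiency hT (conj z)).orthogonalProjectionOnto a - cayleyRestrict hT hz
      ((hermitianDeficiency hT z).orthogonalProjectionOnto a) = 0 ↔ a = 0 := by
  refine ⟨fun h => eq_zero_of_cayley_eq hT hz ?_, fun h => by simp [h]⟩
  have := sub_cayley_eq_of_mem_orthogonal hT hz ha
  rw [h, Submodule.coe_zero, sub_eq_zero] at this
  exact this.symm

theorem gammaForm_eq_norm_defectOp_sq (f : T.domain) :
    gammaForm T f = (4 * z.im)⁻¹ * ‖(defectOp (cayleyRestrict hT hz) ∘L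
      (hermitianDeficiency hT z).orthogonalProjectionOnto) (shift T (conj z) f)‖ ^ 2 := by
  rw [comp_apply, norm_defectOp_proj_sq, cayley_shift, norm_shift_sq, gammaForm]
  field_simp

/-! ### Singularity of `γ_T` -/

/-- Under `h = (T - z̄ I) f` the domain of `T` becomes `H`, the vector `f` becomes a multiple of
`(I - Y_z) h`, and `γ_T[f]` a multiple of `‖D_{M_z} P_{𝔑_z} h‖²`. -/
theorem isSingularForm_gammaForm_iff :
    IsSingularForm (gammaForm T) ↔ ∀ h, ∃ u : ℕ → H,
      Tendsto (fun n => (1 - cayley hT hz) (u n)) atTop (𝓝 0) ∧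
      Tendsto (fun n => (defectOp (cayleyRestrict hT hz) ∘L
        (hermitianDeficiency hT z).orthogonalProjectionOnto) (h - u n)) atTop (𝓝 0) := by
  set B := defectOp (cayleyRestrict hT hz) ∘L
    (hermitianDeficiency hT z).orthogonalProjectionOnto with hB
  have hne := sub_conj_ne_zero hz
  have h1 : ∀ u : ℕ → T.domain, Tendsto (fun n => (u n : H)) atTop (𝓝 0) ↔
      Tendsto (fun n => (1 - cayley hT hz) (shift T (conj z) (u n))) atTop (𝓝 0) := by
    intro u
    have e : ∀ n, (1 - cayley hT hz) (shift T (conj z) (u n)) = (z - conj z) • (u n : H) :=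
      fun n => sub_cayley_shift hT hz (u n)
    simp only [e]
    rw [← tendsto_const_smul_iff₀ hne, smul_zero]
  have h2 : ∀ (φ : T.domain) (u : ℕ → T.domain),
      Tendsto (fun n => gammaForm T (φ - u n)) atTop (𝓝 0) ↔
      Tendsto (fun n => B (shift T (conj z) φ - shift T (conj z) (u n))) atTop (𝓝 0) := by
    intro φ u
    have hc : (4 * z.im)⁻¹ ≠ 0 := by positivity
    have e : ∀ n, gammaForm T (φ - u n) = (4 * z.im)⁻¹ *
        ‖B (shift T (conj z) φ - shift T (conj z) (u n))‖ ^ 2 := fun n => by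
      rw [gammaForm_eq_norm_defectOp_sq hT hz, map_sub]
    simp only [e]
    rw [tendsto_zero_iff_norm_tendsto_zero (f := fun n => B _)]
    constructor
    · intro h
      have h3 := (h.const_mul (4 * z.im)).sqrt
      simpa [← mul_assoc, hz.ne'] using h3
    · intro h
      simpa using (h.pow 2).const_mul (4 * z.im)⁻¹
  constructor
  · intro H h
    obtain ⟨φ, rfl⟩ := shift_surjective hT hz h
    obtain ⟨u, hu, hv⟩ := H φ
    exact ⟨fun n => shift T (conj z) (u n), (h1 u).1 hu, (h2 φ u).1 hv⟩
  · intro H φ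
    obtain ⟨u, hu, hv⟩ := H (shift T (conj z) φ)
    choose w hw using fun n => shift_surjective hT hz (u n)
    simp only [← hw] at hu hv
    exact ⟨w, (h1 w).2 hu, (h2 φ w).2 hv⟩

/-- `γ_T` is singular if and only if `ran (I - Y_z*) ∩ ran D_{M_z} = {0}`; since
`ran D_{M_z} ⊆ 𝔑_z`, only vectors `a ⊥ 𝔖_T` matter, and `I - Y_z*` is injective. -/
theorem dSing_iff_forall_orthogonal :
    DSing T ↔ ∀ a ∈ (hermitianDomain T hT.dissipative)ᗮ,
      (hermitianDeficiency hT z).orthogonalProjectionOnto a - adjoint (cayleyRestrict hT hz)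
        ((hermitianDeficiency hT (conj z)).orthogonalProjectionOnto a) ∈
          LinearMap.range (defectOp (cayleyRestrict hT hz)).toLinearMap → a = 0 := by
  have hadj : ∀ b : hermitianDeficiency hT z, adjoint (defectOp (cayleyRestrict hT hz) ∘L
      (hermitianDeficiency hT z).orthogonalProjectionOnto) b =
      (defectOp (cayleyRestrict hT hz) b : hermitianDeficiency hT z) := fun b => by
    rw [adjoint_comp, (isSelfAdjoint_defectOp _).adjoint_eq,
      Submodule.adjoint_orthogonalProjectionOnto]
    rfl
  have hadj1 : ∀ a, adjoint (1 - cayley hT hz) a = a - adjoint (cayley hT hz) a := fun a => by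
    rw [map_sub, sub_apply, ← star_eq_adjoint, star_one]
    rfl
  rw [DSing, and_iff_right hT, isSingularForm_gammaForm_iff hT hz, forall_exists_seq_iff_adjoint]
  simp only [hadj, hadj1]
  constructor
  · rintro H a ha ⟨b, hb⟩
    have e := sub_adjoint_cayley_eq_of_mem_orthogonal hT hz ha
    rw [← hb] at e
    have h0 := H a b e
    refine eq_zero_of_adjoint_cayley_eq hT hz (sub_eq_zero.1 (e.trans h0)).symm
  · intro H a b hab
    have ha := mem_orthogonal_of_sub_adjoint_cayley_mem hT hz (a := a)
      (by rw [hab]; exact Subtype.prop _)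
    have e := sub_adjoint_cayley_eq_of_mem_orthogonal hT hz ha
    have h0 := H a ha ⟨b, Subtype.ext (hab.symm.trans e)⟩
    rw [← hab, h0, map_zero, sub_zero]

theorem dSing_iff_range_defectOp_inf :
    DSing T ↔ LinearMap.range (defectOp (cayleyRestrict hT hz)).toLinearMap ⊓
      Submodule.map ((hermitianDeficiency hT z).orthogonalProjectionOnto -
        adjoint (cayleyRestrict hT hz) ∘L
          (hermitianDeficiency hT (conj z)).orthogonalProjectionOnto).toLinearMap
        (hermitianDomain T hT.dissipative)ᗮ = ⊥ := by
  rw [dSing_iff_forall_orthogonal hT hz, Submodule.eq_bot_iff]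
  constructor
  · rintro H _ ⟨hr, a, ha, rfl⟩
    exact (proj_sub_adjoint_cayleyRestrict_eq_zero_iff hT hz ha).2 (H a ha hr)
  · intro H a ha hr
    exact (proj_sub_adjoint_cayleyRestrict_eq_zero_iff hT hz ha).1 (H _ ⟨hr, a, ha, rfl⟩)

/-- The dual form of `dSing_iff_range_defectOp_inf`: for `x = P_{𝔑_z} a` and `y = P_{𝔑_z̄} a` the
conditions `x - M* y ∈ ran D_M` and `y - M x ∈ ran D_{M*}` are equivalent, and each of the two
vectors vanishes only for `a = 0`. -/
theorem dSing_iff_range_defectOp_adjoint_inf :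
    DSing T ↔ LinearMap.range (defectOp (adjoint (cayleyRestrict hT hz))).toLinearMap ⊓
      Submodule.map ((hermitianDeficiency hT (conj z)).orthogonalProjectionOnto -
        cayleyRestrict hT hz ∘L
          (hermitianDeficiency hT z).orthogonalProjectionOnto).toLinearMap
        (hermitianDomain T hT.dissipative)ᗮ = ⊥ := by
  simp only [dSing_iff_forall_orthogonal hT hz, Submodule.eq_bot_iff,
    sub_adjoint_apply_mem_range_defectOp_iff (norm_cayleyRestrict_le hT hz)]
  constructor
  · rintro H _ ⟨hr, a, ha, rfl⟩
    exact (proj_sub_cayleyRestrict_eq_zero_iff hT hz ha).2 (H a ha hr)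
  · intro H a ha hr
    exact (proj_sub_cayleyRestrict_eq_zero_iff hT hz ha).1 (H _ ⟨hr, a, ha, rfl⟩)

theorem dense_hermitianDomain_of_dSing (hM : ‖cayleyRestrict hT hz‖ < 1) (h : DSing T) :
    Dense (hermitianDomain T hT.dissipative : Set H) := by
  rw [Submodule.dense_iff_topologicalClosure_eq_top, Submodule.topologicalClosure_eq_top_iff,
    Submodule.eq_bot_iff]
  intro a ha
  refine (dSing_iff_forall_orthogonal hT hz).1 h a ha ?_
  rw [range_defectOp_eq_top hM]
  trivial

theorem norm_cayleyRestrict_lt_one [FiniteDimensional ℂ (hermitianDeficiency hT z)] :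
    ‖cayleyRestrict hT hz‖ < 1 :=
  norm_lt_one_of_finiteDimensional (norm_cayleyRestrict_apply_lt hT hz)

theorem norm_cayleyRestrict_lt_one_of_conj
    [FiniteDimensional ℂ (hermitianDeficiency hT (conj z))] : ‖cayleyRestrict hT hz‖ < 1 := by
  rw [← LinearIsometryEquiv.norm_map adjoint]
  exact norm_lt_one_of_finiteDimensional fun y hy =>
    norm_adjoint_apply_lt (norm_cayleyRestrict_apply_lt hT hz) hy

end Cayley

theorem dSing_of_dense_hermitianDomain [CompleteSpace H] (hT : IsMaximalDissipative T)
    (hd : Dense (hermitianDomain T hT.dissipative : Set H)) : DSing T := by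
  have hI : 0 < Complex.I.im := by simp
  rw [dSing_iff_forall_orthogonal hT hI]
  intro a ha _
  exact hd.eq_zero_of_inner_right (𝕜 := ℂ) fun f hf => (Submodule.mem_orthogonal _ _).1 ha f hf

/-! ### The Hermitian domain and the domain of the adjoint -/

section Adjoint

theorem gammaForm_add (f g : T.domain) :
    gammaForm T (f + g) = gammaForm T f + gammaForm T g +
      (inner ℂ (f : H) (T g) - inner ℂ (T f) (g : H)).im := by
  have h : (inner ℂ (g : H) (T f)).im = -(inner ℂ (T f) (g : H)).im := by
    rw [← inner_conj_symm, Complex.conj_im]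
  simp only [gammaForm, LinearPMap.map_add, Submodule.coe_add, inner_add_left, inner_add_right,
    Complex.add_im, Complex.sub_im, h]
  ring

theorem gammaForm_smul (c : ℂ) (f : T.domain) :
    gammaForm T (c • f) = ‖c‖ ^ 2 * gammaForm T f := by
  rw [gammaForm, LinearPMap.map_smul, Submodule.coe_smul, inner_smul_left, inner_smul_right,
    ← mul_assoc, mul_comm (conj c) c, Complex.mul_conj, Complex.normSq_eq_norm_sq,
    Complex.im_ofReal_mul, gammaForm]

theorem im_inner_sub_eq_zero (hT : IsDissipative T) {f : T.domain} (hf : gammaForm T f = 0)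
    (g : T.domain) : (inner ℂ (f : H) (T g) - inner ℂ (T f) (g : H)).im = 0 := by
  set c := (inner ℂ (f : H) (T g) - inner ℂ (T f) (g : H)).im with hc
  -- `t ↦ γ_T[t f + g] = γ_T[g] + t c` is affine and nonnegative, hence constant
  have key : ∀ t : ℝ, 0 ≤ gammaForm T g + t * c := by
    intro t
    have h := hT ((t : ℂ) • f + g)
    change 0 ≤ gammaForm T _ at h
    rw [gammaForm_add, gammaForm_smul, hf, LinearPMap.map_smul, Submodule.coe_smul,
      inner_smul_left, inner_smul_left, Complex.conj_ofReal, ← mul_sub,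
      Complex.im_ofReal_mul, ← hc] at h
    linarith
  by_contra hne
  have h := key (-(gammaForm T g + 1) / c)
  rw [div_mul_cancel₀ _ hne] at h
  linarith

theorem inner_apply_eq_of_gammaForm_eq_zero (hT : IsDissipative T) {f : T.domain}
    (hf : gammaForm T f = 0) (g : T.domain) :
    inner ℂ (T f) (g : H) = inner ℂ (f : H) (T g) := by
  have h1 := im_inner_sub_eq_zero hT hf g
  have h2 := im_inner_sub_eq_zero hT (f := Complex.I • f)
    (by rw [gammaForm_smul, hf, mul_zero]) g
  rw [LinearPMap.map_smul, Submodule.coe_smul, inner_smul_left, inner_smul_left, ← mul_sub] at h2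
  refine (sub_eq_zero.1 (Complex.ext ?_ h1)).symm
  rw [Complex.zero_re, ← neg_eq_zero, ← h2]
  simp

variable [CompleteSpace H]

theorem hermitianDomain_le_adjoint_domain (hT : IsMaximalDissipative T) :
    hermitianDomain T hT.dissipative ≤ T.domain ⊓ T.adjoint.domain := by
  rintro f ⟨hfd, hf⟩
  refine ⟨hfd, LinearPMap.mem_adjoint_domain_of_exists _ ⟨T ⟨f, hfd⟩, fun g => ?_⟩⟩
  exact inner_apply_eq_of_gammaForm_eq_zero hT.dissipative hf g

/-- If `f ∈ dom T ∩ dom T*`, then the sesquilinear form `γ_T(f, ·)` is continuous with respect to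
the norm of `H`, so that `γ_T[f]` can be evaluated along an approximating sequence. -/
theorem domain_inf_adjoint_domain_le_hermitianDomain (hT : IsMaximalDissipative T)
    (hs : IsSingularForm (gammaForm T)) :
    T.domain ⊓ T.adjoint.domain ≤ hermitianDomain T hT.dissipative := by
  rintro f ⟨hfd, hfa⟩
  obtain ⟨u, hu, hv⟩ := hs ⟨f, hfd⟩
  have hadj : ∀ g : T.domain, inner ℂ (T.adjoint ⟨f, hfa⟩) (g : H) = inner ℂ f (T g) :=
    LinearPMap.adjoint_isFormalAdjoint hT.dense_domain ⟨f, hfa⟩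
  have hle : ∀ n, gammaForm T ⟨f, hfd⟩ ≤ gammaForm T (⟨f, hfd⟩ - u n) +
      (inner ℂ (T.adjoint ⟨f, hfa⟩ - T ⟨f, hfd⟩) (u n : H)).im := by
    intro n
    have h1 := gammaForm_add (⟨f, hfd⟩ : T.domain) (-u n)
    have h2 : 0 ≤ gammaForm T (-u n) := hT.dissipative _
    rw [← sub_eq_add_neg, LinearPMap.map_neg, Submodule.coe_neg, inner_neg_right, inner_neg_right,
      ← hadj, sub_neg_eq_add, neg_add_eq_sub, ← inner_sub_left, ← neg_sub (T.adjoint ⟨f, hfa⟩) (T ⟨f, hfd⟩),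
      inner_neg_left, Complex.neg_im] at h1
    linarith
  have hlim : Tendsto (fun n => gammaForm T (⟨f, hfd⟩ - u n) +
      (inner ℂ (T.adjoint ⟨f, hfa⟩ - T ⟨f, hfd⟩) (u n : H)).im) atTop (𝓝 0) := by
    have h3 := (tendsto_const_nhds (x := T.adjoint ⟨f, hfa⟩ - T ⟨f, hfd⟩)).inner (𝕜 := ℂ) hu
    rw [inner_zero_right] at h3
    have h4 := hv.add ((Complex.continuous_im.tendsto _).comp h3)
    rwa [Complex.zero_im, add_zero] at h4
  exact ⟨hfd, le_antisymm (ge_of_tendsto' hlim hle) (hT.dissipative _)⟩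

end Adjoint

end DissipativeOp

theorem theorem4p4 {H : Type*} [NormedAddCommGroup H] [InnerProductSpace ℂ H] [CompleteSpace H]
    (T : H →ₗ.[ℂ] H) (hT : IsMaximalDissipative T) :
    -- (1) the criteria, for each `z` in the open upper half-plane
    (hermitianDomain T hT.dissipative ≠ ⊥ → ∀ (z : ℂ) (hz : 0 < z.im),
      (DSing T ↔
        LinearMap.range (defectOp (ContinuousLinearMap.adjoint (cayleyRestrict hT hz))).toLinearMap ⊓
          Submodule.map
            ((deficiencySubspace (hermitianPart T hT.dissipative)
                (conj z)).orthogonalProjectionOnto -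
              cayleyRestrict hT hz ∘L
                (deficiencySubspace (hermitianPart T hT.dissipative)
                  z).orthogonalProjectionOnto).toLinearMap
            (hermitianDomain T hT.dissipative)ᗮ = ⊥) ∧
      (DSing T ↔
        LinearMap.range (defectOp (cayleyRestrict hT hz)).toLinearMap ⊓
          Submodule.map
            ((deficiencySubspace (hermitianPart T hT.dissipative) z).orthogonalProjectionOnto -
              ContinuousLinearMap.adjoint (cayleyRestrict hT hz) ∘L
                (deficiencySubspace (hermitianPart T hT.dissipative)
                  (conj z)).orthogonalProjectionOnto).toLinearMap
            (hermitianDomain T hT.dissipative)ᗮ = ⊥)) ∧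
    -- (a)
    (Dense (hermitianDomain T hT.dissipative : Set H) → DSing T) ∧
    -- (b), and the sufficient condition for `‖M_z‖ < 1`
    (hermitianDomain T hT.dissipative ≠ ⊥ →
      ¬ Dense (hermitianDomain T hT.dissipative : Set H) →
      (∃ (z : ℂ) (hz : 0 < z.im), ‖cayleyRestrict hT hz‖ < 1) → ¬ DSing T) ∧
    (∀ (z : ℂ) (hz : 0 < z.im),
      FiniteDimensional ℂ (deficiencySubspace (hermitianPart T hT.dissipative) z) →
      ‖cayleyRestrict hT hz‖ < 1) ∧
    -- (2)
    (DSing T → hermitianDomain T hT.dissipative = T.domain ⊓ T.adjoint.domain) ∧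
    -- the corollary: both deficiency indices of the Hermitian part are infinite
    (DSing T → hermitianDomain T hT.dissipative ≠ ⊥ →
      ¬ Dense (hermitianDomain T hT.dissipative : Set H) →
      ∀ w : ℂ, w.im ≠ 0 →
        ¬ FiniteDimensional ℂ (deficiencySubspace (hermitianPart T hT.dissipative) w)) := by
  refine ⟨fun _ z hz => ⟨dSing_iff_range_defectOp_adjoint_inf hT hz,
      dSing_iff_range_defectOp_inf hT hz⟩, dSing_of_dense_hermitianDomain hT, ?_, ?_, ?_, ?_⟩
  · rintro - hd ⟨z, hz, hM⟩ h
    exact hd (dense_hermitianDomain_of_dSing hT hz hM h)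
  · intro z hz _
    exact norm_cayleyRestrict_lt_one hT hz
  · intro h
    exact le_antisymm (hermitianDomain_le_adjoint_domain hT)
      (domain_inf_adjoint_domain_le_hermitianDomain hT h.2)
  · intro h _ hd w hw _
    rcases hw.lt_or_gt with hneg | hpos
    · obtain ⟨z, rfl⟩ : ∃ z, w = conj z := ⟨conj w, (Complex.conj_conj w).symm⟩
      have hz : 0 < z.im := by simpa using hneg
      exact hd (dense_hermitianDomain_of_dSing hT hz (norm_cayleyRestrict_lt_one_of_conj hT hz) h)
    · exact hd (dense_hermitianDomain_of_dSing hT hpos (norm_cayleyRestrict_lt_one hT hpos) h)
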